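/- Let $\mathbb F$ be a finite field. A linear code over $\mathbb F$ with finite index set $I$ is a subspace $\mathcal C\subseteq\mathbb F^I$; an $[n,k,d]$ code has length $n=|I|$, dimension $k$ and minimum distance $d$ (the least Hamming weight of a nonzero codeword, and, by convention, $d=0$ for the zero code). A graphical model on a finite connected graph $\mathcal G=(V,E)$ consists of a map $\omega:I\to V$, a finite-dimensional $\mathbb F$-vector space $\mathcal S_e$ for each $e\in E$, and, for each $v\in V$, a subspace $C_v\subseteq\mathbb F^{\omega^{-1}(v)}\oplus\bigoplus_{e\in E(v)}\mathcal S_e$, where $E(v)$ is the set of edges incident with $v$. Its full behavior $\mathfrak B\subseteq\mathbb F^I\oplus\bigoplus_{e\in E}\mathcal S_e$ is the set of all $((x_i)_{i\in I},(\mathbf s_e)_{e\in E})$ with $((x_i)_{i\in\omega^{-1}(v)},(\mathbf s_e)_{e\in E(v)})\in C_v$ for every $v\in V$. The model is a realization of $\mathcal C$ on $\mathcal G$ if $\mathfrak B$ projects onto every $C_v$ and onto every $\mathcal S_e$, and the projection of $\mathfrak B$ to $\mathbb F^I$ equals $\mathcal C$. The treewidth $\kappa_{\mathrm{tree}}(\mathcal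 C)$ is the minimum of $\max_{v\in V}\dim C_v$ over all realizations of $\mathcal C$ on finite trees. A family $\mathfrak C$ of linear codes over $\mathbb F$ is asymptotically good if it contains a sequence of $[n_i,k_i,d_i]$ codes with $n_i\to\infty$, $\liminf_i k_i/n_i>0$ and $\liminf_i d_i/n_i>0$. **Corollary.** Let $(\mathcal C^{(i)})_i$ be a sequence of $[n_i,k_i,d_i]$ linear codes over $\mathbb F$, with $n_i>1$ for all sufficiently large $i$, such that $$\lim_{i\to\infty}\kappa_{\mathrm{tree}}(\mathcal C^{(i)})\,\frac{\log n_i}{n_i}=0 .$$ Then $\lim_{i\to\infty}\min\{k_i/n_i,\;d_i/n_i\}=0$. Consequently, if at least one of the sequences $(k_i/n_i)_i$ and $(d_i/n_i)_i$ converges, then $\lim_{i\to\infty}k_i/n_i=0$ or $\lim_{i\to\infty}d_i/n_i=0$. In particular, for each integer $t\ge 0$, the family $\mathsf{TW}(t)$ of all linear codes over $\mathbb F$ of treewidth at most $t$ is not asymptotically good. -/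

import Mathlib

/-!
Graphical models over a field `F`, tree realizations of linear codes, the treewidth of a linear
code, and asymptotically good code families.  A linear code with index set `I` is a subspace of
`I → F`.
-/

open Filter Topology

universe u v w

/-- A graphical model on the graph `G`, with symbol index set `I`: an index mapping `ω : I → V`,
a (finite-dimensional) state space for each edge, and at each vertex `x` a local constraint code,
which is a subspace of `F^(ω⁻¹(x)) ⊕ ⨁_{e ∈ E(x)} S_e`. -/
structure GraphicalModel (F : Type u) [Field F] (I : Type v) {V : Type w}
    (G : SimpleGraph V) where
  /-- the index mapping -/
  ω : I → V
  /-- the state spaces -/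
  S : G.edgeSet → Type u
  [instAddCommGroup : ∀ e, AddCommGroup (S e)]
  [instModule : ∀ e, Module F (S e)]
  [instFiniteDimensional : ∀ e, FiniteDimensional F (S e)]
  /-- the local constraint codes -/
  C : ∀ x : V, Submodule F
    (({i : I // ω i = x} → F) × (∀ e : {e : G.edgeSet // x ∈ (e : Sym2 V)}, S e.1))

namespace GraphicalModel

attribute [instance] instAddCommGroup instModule instFiniteDimensional

variable {F : Type u} [Field F] {I : Type v} {V : Type w} {G : SimpleGraph V}

/-- The space of all global configurations `((x_i)_{i ∈ I}, (s_e)_{e ∈ E})`. -/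
abbrev Config (Γ : GraphicalModel F I G) : Type (max u v w) :=
  (I → F) × (∀ e : G.edgeSet, Γ.S e)

/-- The passage from a global configuration `b` to its local configuration at the vertex `x`,
`((x_i)_{i ∈ ω⁻¹(x)}, (s_e)_{e ∈ E(x)})`. -/
def localMap (Γ : GraphicalModel F I G) (x : V) :
    Γ.Config →ₗ[F]
      (({i : I // Γ.ω i = x} → F) ×
        (∀ e : {e : G.edgeSet // x ∈ (e : Sym2 V)}, Γ.S e.1)) where
  toFun b := (fun i => b.1 i.1, fun e => b.2 e.1)
  map_add' _ _ := rfl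
  map_smul' _ _ := rfl

/-- The passage from a global configuration to its state at the edge `e`. -/
def stateMap (Γ : GraphicalModel F I G) (e : G.edgeSet) : Γ.Config →ₗ[F] Γ.S e where
  toFun b := b.2 e
  map_add' _ _ := rfl
  map_smul' _ _ := rfl

/-- The full behavior: the global configurations that satisfy all the local constraints. -/
def behavior (Γ : GraphicalModel F I G) : Submodule F Γ.Config :=
  ⨅ x : V, (Γ.C x).comap (Γ.localMap x)

/-- The model is essential: the full behavior projects onto every local constraint code and onto
every state space. -/
def IsEssential (Γ : GraphicalModel F I G) : Prop :=
  (∀ x : V, Γ.behavior.map (Γ.localMap x) = Γ.C x) ∧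
    ∀ e : G.edgeSet, Γ.behavior.map (Γ.stateMap e) = ⊤

/-- The model is a graphical realization of the code `C`: it is essential, and the projection of
the full behavior onto the symbol coordinates is `C`. -/
def IsRealization (Γ : GraphicalModel F I G) (C : Submodule F (I → F)) : Prop :=
  Γ.IsEssential ∧ Γ.behavior.map (LinearMap.fst F (I → F) (∀ e : G.edgeSet, Γ.S e)) = C

/-- The constraint max-complexity: the largest dimension of a local constraint code. -/
noncomputable def kappa [Fintype V] (Γ : GraphicalModel F I G) : ℕ :=
  Finset.univ.sup fun x : V => Module.finrank F (Γ.C x)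

end GraphicalModel

/-- The treewidth `κ_tree(C)` of a linear code: the least constraint max-complexity of a
realization of the code on a finite tree. -/
noncomputable def codeTreewidth {F : Type u} [Field F] {I : Type v}
    (C : Submodule F (I → F)) : ℕ :=
  sInf {m : ℕ | ∃ (V : Type) (_ : Fintype V) (T : SimpleGraph V) (Γ : GraphicalModel F I T),
    T.IsTree ∧ Γ.IsRealization C ∧ Γ.kappa = m}

/-- The minimum distance of a linear code, i.e. the least Hamming weight of a nonzero codeword
(with the value `0` for the zero code, which has no nonzero codeword). -/
noncomputable def minDist {F : Type u} [Field F] [DecidableEq F] {I : Type v} [Fintype I]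
    (C : Submodule F (I → F)) : ℕ :=
  sInf {m : ℕ | ∃ c ∈ C, c ≠ 0 ∧ hammingNorm c = m}

/-- Linear codes over `F` of arbitrary finite length. -/
abbrev LinCode (F : Type u) [Field F] : Type u :=
  Σ n : ℕ, Submodule F (Fin n → F)

namespace LinCode

variable {F : Type u} [Field F]

/-- The length `n` of a code. -/
def length (C : LinCode F) : ℕ := C.1

/-- The dimension `k` of a code. -/
noncomputable def dim (C : LinCode F) : ℕ := Module.finrank F C.2

/-- The minimum distance `d` of a code. -/
noncomputable def dist [DecidableEq F] (C : LinCode F) : ℕ := minDist C.2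

/-- The treewidth of a code. -/
noncomputable def treewidth (C : LinCode F) : ℕ := codeTreewidth C.2

/-- The rate `k / n`. -/
noncomputable def rate (C : LinCode F) : ℝ := (C.dim : ℝ) / (C.length : ℝ)

/-- The relative minimum distance `d / n`. -/
noncomputable def relDist [DecidableEq F] (C : LinCode F) : ℝ :=
  (C.dist : ℝ) / (C.length : ℝ)

end LinCode

/-- A family of codes is asymptotically good if it contains a sequence of `[n_i, k_i, d_i]` codes
with `n_i → ∞` such that `liminf k_i / n_i > 0` and `liminf d_i / n_i > 0`. -/
def AsymptoticallyGood {F : Type u} [Field F] [DecidableEq F] (𝓕 : Set (LinCode F)) : Prop :=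
  ∃ C : ℕ → LinCode F, (∀ i, C i ∈ 𝓕) ∧
    Tendsto (fun i => (C i).length) atTop atTop ∧
    0 < liminf (fun i => (C i).rate) atTop ∧
    0 < liminf (fun i => (C i).relDist) atTop

/-- The family `TW(t)` of all codes over `F` of treewidth at most `t`. -/
def TW (F : Type u) [Field F] (t : ℕ) : Set (LinCode F) :=
  {C | C.treewidth ≤ t}

/-! Everything rests on `k * d ≤ κ * n` for a tree realization (`finrank_mul_minDist_le`). Weight
each tree vertex by its number of symbols. By `exists_separator` there is a set `X` of at most `n /
d` vertices whose removal leaves components of weight below `d`. If a behavior element vanishes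
locally on `X`, its restriction to any component is again in the behavior (`restrict_mem_behavior`),
so its symbols form a codeword of weight below `d`, which is zero. Thus a codeword is determined by
local data on `X`, and `k ≤ |X| * κ`. Dividing by `n ^ 2` gives `(k/n) * (d/n) ≤ κ / n`, and the
square of the minimum is at most this product. -/

/-! ### Separators in trees -/

namespace SimpleGraph

variable {V : Type*} {T : SimpleGraph V}

/-- In a tree, each vertex has at most one neighbour that is closer to a given root. -/
theorem IsTree.eq_of_adj_of_dist_lt (hT : T.IsTree) {r v u u' : V}
    (hu : T.Adj v u) (hu' : T.Adj v u') (h : T.dist r u < T.dist r v)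
    (h' : T.dist r u' < T.dist r v) : u = u' := by
  classical
  obtain ⟨p, hp, -⟩ := (hT.connected r v).exists_path_of_dist
  -- If `w` were off the path `p`, the geodesic from `r` to `w` would pass through `v`, making `v`
  -- no farther than `w`.
  have key : ∀ w, T.Adj v w → T.dist r w < T.dist r v → w = p.penultimate := by
    intro w hw hlt
    obtain ⟨q, hq, hql⟩ := (hT.connected r w).exists_path_of_dist
    refine hT.isAcyclic.eq_penultimate_of_adj_end hp hw ?_
    refine hT.isAcyclic.mem_support_of_ne_mem_support_of_adj_of_isPath hp hq hw fun hv => ?_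
    have h1 := T.dist_le (q.takeUntil v hv)
    have h2 := q.length_takeUntil_le_length hv
    omega
  rw [key u hu h, key u' hu' h']

/-- Every nonempty finite set of vertices of a tree contains a vertex with at most one neighbour
in the set. -/
theorem IsTree.exists_mem_forall_adj_eq (hT : T.IsTree) {S : Finset V} (hS : S.Nonempty) :
    ∃ v ∈ S, ∀ u ∈ S, ∀ u' ∈ S, T.Adj v u → T.Adj v u' → u = u' := by
  obtain ⟨r, -⟩ := id hS
  -- Adjacent vertices of a tree have different distances from `r`, so all neighbours in `S` of a
  -- farthest vertex are closer to `r`.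
  obtain ⟨v, hv, hmax⟩ := S.exists_max_image (T.dist r) hS
  refine ⟨v, hv, fun u hu u' hu' ha ha' => hT.eq_of_adj_of_dist_lt (r := r) ha ha' ?_ ?_⟩
  · exact lt_of_le_of_ne (hmax u hu) (hT.dist_ne_of_adj r ha).symm
  · exact lt_of_le_of_ne (hmax u' hu') (hT.dist_ne_of_adj r ha').symm

/-- In a vertex-weighted tree, at most `W / d` vertices, where `W` is the total weight, can be
deleted so that every component of the rest has weight less than `d`.  The components are recorded
by a labelling `c` of the vertices. -/
theorem IsTree.exists_separator (hT : T.IsTree) [DecidableEq V] {d : ℕ} (hd : 0 < d)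
    (S : Finset V) (w : V → ℕ) :
    ∃ X ⊆ S, ∃ c : V → V, (∀ v ∈ S, c v ∈ S) ∧ X.card * d ≤ ∑ v ∈ S, w v ∧
      (∀ u ∈ S \ X, ∀ v ∈ S \ X, T.Adj u v → c u = c v) ∧
      ∀ a, ∑ v ∈ (S \ X).filter (fun v => c v = a), w v < d := by
  -- A leaf `v` of `S` is peeled off. The weights vary because a light leaf hands its weight to its
  -- neighbour.
  induction S using Finset.strongInduction generalizing w with
  | H S ih =>
  obtain rfl | hS := S.eq_empty_or_nonempty
  · exact ⟨∅, by simp, id, by simp, by simp, by simp, by simpa using fun _ => hd⟩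
  obtain ⟨v, hv, hleaf⟩ := hT.exists_mem_forall_adj_eq hS
  have hss := Finset.erase_ssubset hv
  have hsum : ∀ f : V → ℕ, ∑ x ∈ S, f x = f v + ∑ x ∈ S.erase v, f x := fun f =>
    (Finset.add_sum_erase S f hv).symm
  -- A heavy leaf is deleted: its own weight pays for it.
  by_cases hw : d ≤ w v
  · obtain ⟨X, hXS, c, hc, hcard, hadj, hlt⟩ := ih _ hss w
    have hvX : v ∉ X := fun h => by simpa using hXS h
    have hset : S \ insert v X = S.erase v \ X := by
      ext x; simp only [Finset.mem_sdiff, Finset.mem_insert, Finset.mem_erase]; tauto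
    refine ⟨insert v X, ?_, Function.update c v v, ?_, ?_, ?_, ?_⟩
    · exact Finset.insert_subset hv (hXS.trans hss.subset)
    · intro x hx
      by_cases hxv : x = v
      · simpa [hxv] using hv
      · simpa [hxv] using hss.subset (hc x (by simp [hxv, hx]))
    · rw [Finset.card_insert_of_notMem hvX, hsum, add_mul]
      omega
    · rw [hset]
      intro x hx y hy hxy
      have hxv : x ≠ v := by rintro rfl; simp at hx
      have hyv : y ≠ v := by rintro rfl; simp at hy
      simpa [hxv, hyv] using hadj x hx y hy hxy
    · intro a
      rw [hset]
      refine lt_of_eq_of_lt (Finset.sum_congr (Finset.filter_congr fun x hx => ?_) fun _ _ => rfl)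
        (hlt a)
      have hxv : x ≠ v := by rintro rfl; simp at hx
      simp [hxv]
  push Not at hw
  -- a labelling of `S.erase v` in which `v` becomes a component of its own
  have isolated : ∀ X ⊆ S.erase v, ∀ c : V → V, (∀ x ∈ S.erase v, c x ∈ S.erase v) →
      (∀ x ∈ S.erase v, T.Adj v x → x ∈ X) →
      X.card * d ≤ ∑ x ∈ S, w x →
      (∀ x ∈ S.erase v \ X, ∀ y ∈ S.erase v \ X, T.Adj x y → c x = c y) →
      (∀ a, ∑ x ∈ (S.erase v \ X).filter (fun x => c x = a), w x < d) →
      ∃ X ⊆ S, ∃ c : V → V, (∀ x ∈ S, c x ∈ S) ∧ X.card * d ≤ ∑ x ∈ S, w x ∧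
        (∀ x ∈ S \ X, ∀ y ∈ S \ X, T.Adj x y → c x = c y) ∧
        ∀ a, ∑ x ∈ (S \ X).filter (fun x => c x = a), w x < d := by
    intro X hXS c hc hnb hcard hadj hlt
    refine ⟨X, hXS.trans hss.subset, Function.update c v v, ?_, hcard, ?_, ?_⟩
    · intro x hx
      by_cases hxv : x = v
      · simpa [hxv] using hv
      · simpa [hxv] using hss.subset (hc x (by simp [hxv, hx]))
    · intro x hx y hy hxy
      rw [Finset.mem_sdiff] at hx hy
      by_cases hxv : x = v
      · subst hxv
        exact absurd (hnb y (by simp [hxy.ne', hy.1]) hxy) hy.2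
      by_cases hyv : y = v
      · subst hyv
        exact absurd (hnb x (by simp [hxy.ne, hx.1]) hxy.symm) hx.2
      simpa [hxv, hyv] using hadj x (by simp [hxv, hx]) y (by simp [hyv, hy]) hxy
    · intro a
      by_cases hav : a = v
      · subst hav
        refine lt_of_le_of_lt (Finset.sum_le_sum_of_subset (t := {a}) fun x hx => ?_) (by simpa)
        simp only [Finset.mem_filter, Finset.mem_sdiff] at hx
        by_contra hxa
        rw [Finset.mem_singleton] at hxa
        -- The label `v` is fresh, since `c` maps `S.erase v` to itself.
        have := hc x (by simp [hxa, hx.1.1])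
        rw [Function.update_of_ne hxa] at hx
        simp [hx.2] at this
      · refine lt_of_le_of_lt (Finset.sum_le_sum_of_subset fun x hx => ?_) (hlt a)
        simp only [Finset.mem_filter, Finset.mem_sdiff, Finset.mem_erase] at hx ⊢
        by_cases hxv : x = v
        · subst hxv
          simp at hx
          exact absurd hx.2.symm hav
        · simpa [hxv] using hx
  by_cases hnb : ∃ u ∈ S.erase v, T.Adj v u
  swap
  · push Not at hnb
    obtain ⟨X, hXS, c, hc, hcard, hadj, hlt⟩ := ih _ hss w
    refine isolated X hXS c hc (fun x hx h => absurd h (hnb x hx)) ?_ hadj hlt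
    rw [hsum]
    omega
  obtain ⟨u, huS, hvu⟩ := hnb
  -- Moving the weight of `v` to its only neighbour `u` preserves the total.
  obtain ⟨X, hXS, c, hc, hcard, hadj, hlt⟩ := ih _ hss (Function.update w u (w u + w v))
  have hcard' : X.card * d ≤ ∑ x ∈ S, w x := by
    refine hcard.trans_eq ?_
    rw [hsum, Finset.sum_update_of_mem huS, ← Finset.add_sum_erase _ w huS,
      Finset.sdiff_singleton_eq_erase]
    ring
  have hu_uniq : ∀ x ∈ S.erase v, T.Adj v x → x = u := fun x hx h =>
    hleaf x (hss.subset hx) u (hss.subset huS) h hvu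
  -- If `u` is deleted, `v` is a component by itself; otherwise `v` joins the component of `u`,
  -- where its weight is already counted.
  by_cases huX : u ∈ X
  · refine isolated X hXS c hc (fun x hx h => hu_uniq x hx h ▸ huX) hcard' hadj fun a => ?_
    refine lt_of_eq_of_lt (Finset.sum_congr rfl fun x hx => ?_) (hlt a)
    rw [Function.update_of_ne]
    rintro rfl
    simp [huX] at hx
  · have hvX : v ∉ X := fun h => by simpa using hXS h
    have hset : S \ X = insert v (S.erase v \ X) := by
      ext x
      simp only [Finset.mem_sdiff, Finset.mem_insert, Finset.mem_erase]
      by_cases hxv : x = v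
      · subst hxv; simp [hv, hvX]
      · simp [hxv]
    have hnot : ∀ x ∈ S.erase v \ X, x ≠ v := by
      rintro x hx rfl
      simp at hx
    have hu_mem : u ∈ S.erase v \ X := Finset.mem_sdiff.2 ⟨huS, huX⟩
    refine ⟨X, hXS.trans hss.subset, Function.update c v (c u), ?_, hcard', ?_, ?_⟩
    · intro x hx
      by_cases hxv : x = v
      · simpa [hxv] using hss.subset (hc u huS)
      · simpa [hxv] using hss.subset (hc x (by simp [hxv, hx]))
    · have aux : ∀ y ∈ S.erase v \ X, T.Adj v y → c y = c u := fun y hy h => by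
        rw [hu_uniq y (Finset.mem_sdiff.1 hy).1 h]
      rw [hset]
      intro x hx y hy hxy
      rw [Finset.mem_insert] at hx hy
      rcases hx with rfl | hx <;> rcases hy with rfl | hy
      · rfl
      · simpa [hnot y hy] using (aux y hy hxy).symm
      · simpa [hnot x hx] using aux x hx hxy.symm
      · simpa [hnot x hx, hnot y hy] using hadj x hx y hy hxy
    · intro a
      have hfc : (S.erase v \ X).filter (fun x => Function.update c v (c u) x = a) =
          (S.erase v \ X).filter (fun x => c x = a) :=
        Finset.filter_congr fun x hx => by simp [hnot x hx]
      refine lt_of_eq_of_lt ?_ (hlt a)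
      rw [hset, Finset.filter_insert, hfc]
      by_cases hca : c u = a
      · have hmem : u ∈ (S.erase v \ X).filter (fun x => c x = a) :=
          Finset.mem_filter.2 ⟨hu_mem, hca⟩
        rw [if_pos (by simpa using hca), Finset.sum_insert (by simp),
          Finset.sum_update_of_mem hmem, ← Finset.add_sum_erase _ w hmem,
          Finset.sdiff_singleton_eq_erase]
        ring
      · rw [if_neg (by simpa using hca), Finset.sum_update_of_notMem]
        simp [hca]

end SimpleGraph

/-! ### Decomposition of the full behavior -/

namespace GraphicalModel

variable {F : Type*} [Field F] {I V : Type*} {G : SimpleGraph V}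

theorem mem_behavior {Γ : GraphicalModel F I G} {b : Γ.Config} :
    b ∈ Γ.behavior ↔ ∀ x, Γ.localMap x b ∈ Γ.C x := by
  simp [behavior]

open Classical in
/-- The restriction of a configuration to the symbols at the vertices in `P` and the states of the
edges meeting `P`. -/
noncomputable def restrict (Γ : GraphicalModel F I G) (P : V → Prop) (b : Γ.Config) : Γ.Config :=
  (fun i => if P (Γ.ω i) then b.1 i else 0,
    fun e => if ∃ v ∈ (e : Sym2 V), P v then b.2 e else 0)

/-- A global configuration of the behavior that vanishes locally on the outer boundary of `P`
remains in the behavior when it is restricted to `P`. -/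
theorem restrict_mem_behavior {Γ : GraphicalModel F I G} {P : V → Prop} {b : Γ.Config}
    (hb : b ∈ Γ.behavior) (h : ∀ u v, G.Adj u v → P u → ¬ P v → Γ.localMap v b = 0) :
    Γ.restrict P b ∈ Γ.behavior := by
  rw [mem_behavior] at hb ⊢
  intro x
  by_cases hx : P x
  · convert hb x using 1
    refine Prod.ext (funext fun i => ?_) (funext fun e => ?_)
    · exact if_pos (by rwa [i.2])
    · exact if_pos ⟨x, e.2, hx⟩
  · convert (Γ.C x).zero_mem
    refine Prod.ext (funext fun i => ?_) (funext fun e => ?_)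
    · exact if_neg (by rwa [i.2])
    · by_cases he : ∃ v ∈ (e.1 : Sym2 V), P v
      · refine (if_pos he).trans ?_
        obtain ⟨v, hve, hv⟩ := he
        have hne : v ≠ x := by rintro rfl; exact hx hv
        have hadj : G.Adj v x := by
          have := (Sym2.mem_and_mem_iff hne).1 ⟨hve, e.2⟩
          rw [← SimpleGraph.mem_edgeSet, ← this]
          exact e.1.2
        exact congrFun (congrArg Prod.snd (h v x hadj hv hx)) e
      · exact if_neg he

/-- If every symbol sequence of a configuration of the behavior that vanishes locally on `X` is
zero, then the dimension of the code is at most the sum of the dimensions of the constraint codes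
on `X`. -/
theorem finrank_map_fst_behavior_le [Finite I] [Finite V] (Γ : GraphicalModel F I G)
    (X : Finset V)
    (h : ∀ b ∈ Γ.behavior, (∀ x ∈ X, Γ.localMap x b = 0) → b.1 = 0) :
    Module.finrank F (Γ.behavior.map (LinearMap.fst F (I → F) (∀ e : G.edgeSet, Γ.S e))) ≤
      ∑ x ∈ X, Module.finrank F (Γ.C x) := by
  classical
  let f : Γ.behavior →ₗ[F] (I → F) := (LinearMap.fst F (I → F) _).comp Γ.behavior.subtype
  let g : Γ.behavior →ₗ[F] (∀ x : X, Γ.C x) := LinearMap.pi fun x =>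
    LinearMap.codRestrict (Γ.C x) ((Γ.localMap x).comp Γ.behavior.subtype)
      fun b => mem_behavior.1 b.2 x
  -- By rank-nullity, this inclusion bounds the rank of `f` by that of `g`.
  have hker : LinearMap.ker g ≤ LinearMap.ker f := fun b hb => by
    refine h b b.2 fun x hx => ?_
    exact congrArg Subtype.val (congrFun (LinearMap.mem_ker.1 hb) ⟨x, hx⟩)
  have hrange : Γ.behavior.map (LinearMap.fst F (I → F) (∀ e : G.edgeSet, Γ.S e)) =
      LinearMap.range f := by
    rw [LinearMap.range_comp, Submodule.range_subtype]
  have h1 := f.finrank_range_add_finrank_ker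
  have h2 := g.finrank_range_add_finrank_ker
  have h3 := Submodule.finrank_mono hker
  have h4 : Module.finrank F (LinearMap.range g) ≤ Module.finrank F (∀ x : X, Γ.C x) :=
    Submodule.finrank_le _
  rw [Module.finrank_pi_fintype, Finset.sum_coe_sort X fun x => Module.finrank F (Γ.C x)] at h4
  rw [hrange]
  omega

end GraphicalModel

/-! ### The dimension-distance inequality -/

theorem minDist_le_hammingNorm {F : Type*} [Field F] [DecidableEq F] {I : Type*} [Fintype I]
    {C : Submodule F (I → F)} {c : I → F} (hc : c ∈ C) (h0 : c ≠ 0) :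
    minDist C ≤ hammingNorm c :=
  Nat.sInf_le ⟨c, hc, h0, rfl⟩

namespace GraphicalModel

/-- The dimension-distance product of a code is at most its length times the constraint
max-complexity of any tree realization. -/
theorem finrank_mul_minDist_le {F : Type*} [Field F] [DecidableEq F] {I V : Type*} [Fintype I]
    [Fintype V] {T : SimpleGraph V} (hT : T.IsTree) {Γ : GraphicalModel F I T}
    {C : Submodule F (I → F)} (hΓ : Γ.IsRealization C) :
    Module.finrank F C * minDist C ≤ Γ.kappa * Fintype.card I := by
  classical
  obtain hd | hd := (minDist C).eq_zero_or_pos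
  · simp [hd]
  obtain ⟨X, -, c, -, hcard, hadj, hlt⟩ := hT.exists_separator hd Finset.univ
    fun v => (Finset.univ.filter fun i => Γ.ω i = v).card
  rw [← Finset.card_eq_sum_card_fiberwise (f := Γ.ω) (s := Finset.univ) (t := Finset.univ)
    (fun _ _ => Finset.mem_coe.2 (Finset.mem_univ _)), Finset.card_univ] at hcard
  have hdim : Module.finrank F C ≤ ∑ x ∈ X, Module.finrank F (Γ.C x) := by
    conv_lhs => rw [← hΓ.2]
    refine Γ.finrank_map_fst_behavior_le X fun b hb hX => ?_
    by_contra hb0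
    obtain ⟨j, hj⟩ := Function.ne_iff.1 hb0
    have hωX : ∀ i, b.1 i ≠ 0 → Γ.ω i ∉ X := fun i hi hiX =>
      hi (congrFun (congrArg Prod.fst (hX _ hiX)) ⟨i, rfl⟩)
    -- The component holding the nonzero symbol `j`; its outer boundary lies in `X`, because
    -- adjacent vertices off `X` share a label.
    set P : V → Prop := fun v => v ∉ X ∧ c v = c (Γ.ω j) with hP
    have hmem : (Γ.restrict P b).1 ∈ C := by
      rw [← hΓ.2]
      refine ⟨_, restrict_mem_behavior hb fun u v huv hu hv => hX v ?_, rfl⟩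
      by_contra hvX
      exact hv ⟨hvX, by rw [← hadj u (by simp [hu.1]) v (by simp [hvX]) huv, hu.2]⟩
    have hne : (Γ.restrict P b).1 ≠ 0 := Function.ne_iff.2
      ⟨j, by simpa [restrict, hP, hωX j hj] using hj⟩
    refine absurd (minDist_le_hammingNorm hmem hne) (not_le.2 (lt_of_le_of_lt ?_ (hlt (c (Γ.ω j)))))
    -- The support of the restricted word lies over `P`, so its size is at most the weight of that
    -- component.
    have hfib := Finset.card_eq_sum_card_fiberwise (f := Γ.ω)
      (s := Finset.univ.filter fun i => (Γ.restrict P b).1 i ≠ 0)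
      (t := (Finset.univ \ X).filter fun v => c v = c (Γ.ω j)) (fun i hi => by
        have hi' : (Γ.restrict P b).1 i ≠ 0 := by simpa using hi
        have hPi : P (Γ.ω i) := by
          by_contra hPi
          exact hi' (if_neg hPi)
        simpa using hPi)
    refine hfib.trans_le (Finset.sum_le_sum fun v _ => Finset.card_le_card fun i hi => ?_)
    simp only [Finset.mem_filter] at hi ⊢
    exact ⟨Finset.mem_univ _, hi.2⟩
  have hsum : ∑ x ∈ X, Module.finrank F (Γ.C x) ≤ X.card * Γ.kappa := by
    refine Finset.sum_le_card_nsmul _ _ _ fun x _ => ?_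
    exact Finset.le_sup (f := fun x => Module.finrank F (Γ.C x)) (Finset.mem_univ x)
  calc Module.finrank F C * minDist C ≤ X.card * Γ.kappa * minDist C :=
        Nat.mul_le_mul_right _ (hdim.trans hsum)
    _ = Γ.kappa * (X.card * minDist C) := by ring
    _ ≤ _ := Nat.mul_le_mul_left _ hcard

/-- The realization of a code on a single vertex. -/
def single {F : Type u} [Field F] {I : Type v} (C : Submodule F (I → F)) :
    GraphicalModel F I (⊥ : SimpleGraph Unit) where
  ω _ := ()
  S _ := PUnit
  C _ := C.comap ((LinearMap.funLeft F F fun i => ⟨i, rfl⟩).comp (LinearMap.fst F _ _))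

theorem single_isRealization {F : Type u} [Field F] {I : Type v} (C : Submodule F (I → F)) :
    (single C).IsRealization C := by
  have hmem : ∀ b, b ∈ (single C).behavior ↔ b.1 ∈ C := fun b =>
    mem_behavior.trans ⟨fun h => h (), fun h _ => h⟩
  refine ⟨⟨fun x => le_antisymm ?_ fun y hy => ?_, fun e => ?_⟩, le_antisymm ?_ fun c hc => ?_⟩
  · rintro _ ⟨b, hb, rfl⟩
    exact mem_behavior.1 hb x
  · refine ⟨(fun i => y.1 ⟨i, rfl⟩, fun _ => PUnit.unit), (hmem _).2 hy, ?_⟩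
    exact Prod.ext rfl (funext fun _ => rfl)
  · exact absurd e.2 (by simp)
  · rintro _ ⟨b, hb, rfl⟩
    exact (hmem b).1 hb
  · exact ⟨(c, fun _ => PUnit.unit), (hmem _).2 hc, rfl⟩

end GraphicalModel

/-- The one-vertex realization makes the set under `sInf` nonempty, so the infimum is attained. -/
theorem exists_kappa_eq_codeTreewidth {F : Type u} [Field F] {I : Type v}
    (C : Submodule F (I → F)) :
    ∃ (V : Type) (_ : Fintype V) (T : SimpleGraph V) (Γ : GraphicalModel F I T),
      T.IsTree ∧ Γ.IsRealization C ∧ Γ.kappa = codeTreewidth C :=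
  Nat.sInf_mem (s := {m : ℕ | ∃ (V : Type) (_ : Fintype V) (T : SimpleGraph V)
    (Γ : GraphicalModel F I T), T.IsTree ∧ Γ.IsRealization C ∧ Γ.kappa = m})
    ⟨_, Unit, inferInstance, ⊥, GraphicalModel.single C, .of_subsingleton,
      GraphicalModel.single_isRealization C, rfl⟩

/-! ### Asymptotics -/

namespace LinCode

variable {F : Type*} [Field F]

theorem rate_nonneg (C : LinCode F) : 0 ≤ C.rate := by unfold rate; positivity

theorem tendsto_treewidth_mul_log_div {C : ℕ → LinCode F} {t : ℕ} (hC : ∀ i, C i ∈ TW F t)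
    (hn : Tendsto (fun i => (C i).length) atTop atTop) :
    Tendsto (fun i => ((C i).treewidth : ℝ) *
      (Real.log ((C i).length : ℝ) / ((C i).length : ℝ))) atTop (𝓝 0) := by
  have hlog : Tendsto (fun i => Real.log ((C i).length : ℝ) / ((C i).length : ℝ)) atTop (𝓝 0) :=
    Real.isLittleO_log_id_atTop.tendsto_div_nhds_zero.comp
      (tendsto_natCast_atTop_atTop.comp hn)
  have h0 : ∀ n : ℕ, 0 ≤ Real.log (n : ℝ) / (n : ℝ) := fun n =>
    div_nonneg (Real.log_natCast_nonneg n) n.cast_nonneg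
  refine squeeze_zero (fun i => mul_nonneg (Nat.cast_nonneg _) (h0 _))
    (fun i => mul_le_mul_of_nonneg_right (Nat.cast_le.2 (hC i)) (h0 _)) ?_
  simpa using hlog.const_mul (t : ℝ)

variable [DecidableEq F]

theorem relDist_nonneg (C : LinCode F) : 0 ≤ C.relDist := by unfold relDist; positivity

theorem dim_mul_dist_le (C : LinCode F) : C.dim * C.dist ≤ C.treewidth * C.length := by
  obtain ⟨V, _, T, Γ, hT, hΓ, hk⟩ := exists_kappa_eq_codeTreewidth C.2
  simpa [hk, dim, dist, treewidth, length] using GraphicalModel.finrank_mul_minDist_le hT hΓ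

theorem rate_mul_relDist_le (C : LinCode F) :
    C.rate * C.relDist ≤ C.treewidth / C.length := by
  -- At length `0` both sides vanish, as division by zero gives `0`.
  obtain h | h := C.length.eq_zero_or_pos
  · simp [rate, h]
  have hn : (0 : ℝ) < C.length := by exact_mod_cast h
  have := C.dim_mul_dist_le
  rw [rate, relDist, div_mul_div_comm, div_le_div_iff₀ (by positivity) hn]
  have : (C.dim * C.dist : ℝ) ≤ C.treewidth * C.length := by exact_mod_cast this
  nlinarith

theorem sq_min_le (C : LinCode F) (hn : 1 < C.length) :
    min C.rate C.relDist ^ 2 ≤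
      2 * (C.treewidth * (Real.log C.length / C.length)) := by
  have hn2 : (2 : ℝ) ≤ C.length := by exact_mod_cast hn
  -- The product bound has no logarithm; `log n ≥ log 2 > 1/2` inserts one at the cost of the factor
  -- `2`.
  have hlog : 1 ≤ 2 * Real.log C.length := by
    have := Real.log_le_log two_pos hn2
    have := Real.log_two_gt_d9
    linarith
  calc min C.rate C.relDist ^ 2 = min C.rate C.relDist * min C.rate C.relDist := sq _
    _ ≤ C.rate * C.relDist := mul_le_mul (min_le_left _ _) (min_le_right _ _)
        (le_min C.rate_nonneg C.relDist_nonneg) C.rate_nonneg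
    _ ≤ C.treewidth / C.length := C.rate_mul_relDist_le
    _ ≤ C.treewidth / C.length * (2 * Real.log C.length) :=
        le_mul_of_one_le_right (by positivity) hlog
    _ = _ := by ring

theorem tendsto_min_rate_relDist {C : ℕ → LinCode F} (hn : ∀ᶠ i in atTop, 1 < (C i).length)
    (h : Tendsto (fun i => ((C i).treewidth : ℝ) *
      (Real.log ((C i).length : ℝ) / ((C i).length : ℝ))) atTop (𝓝 0)) :
    Tendsto (fun i => min (C i).rate (C i).relDist) atTop (𝓝 0) := by
  have hsq : Tendsto (fun i => min (C i).rate (C i).relDist ^ 2) atTop (𝓝 0) := by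
    refine squeeze_zero' (.of_forall fun i => sq_nonneg _)
      (hn.mono fun i hi => (C i).sq_min_le hi) ?_
    simpa using h.const_mul 2
  have := hsq.sqrt
  simp only [Real.sqrt_zero] at this
  exact this.congr fun i => Real.sqrt_sq (le_min (C i).rate_nonneg (C i).relDist_nonneg)

end LinCode

/-- If the minimum of two sequences tends to `0` and one of them converges to a limit that is
positive, then the other one tends to `0`. -/
theorem tendsto_zero_of_tendsto_min {f g : ℕ → ℝ} {r : ℝ} (hr : 0 < r)
    (hf : Tendsto f atTop (𝓝 r)) (hmin : Tendsto (fun i => min (f i) (g i)) atTop (𝓝 0)) :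
    Tendsto g atTop (𝓝 0) := by
  refine hmin.congr' ?_
  -- Eventually `f` exceeds `r / 2` while the minimum is below it, so the minimum is `g`.
  filter_upwards [hf.eventually (lt_mem_nhds (half_lt_self hr)),
    hmin.eventually (gt_mem_nhds (half_pos hr))] with i h1 h2
  exact min_eq_right (le_of_not_ge fun h => by rw [min_eq_left h] at h2; linarith)

theorem mainTheorem6 {F : Type*} [Field F] [Fintype F] [DecidableEq F] :
    (∀ C : ℕ → LinCode F,
      (∀ᶠ i in atTop, 1 < (C i).length) →
      Tendsto (fun i => ((C i).treewidth : ℝ) *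
        (Real.log ((C i).length : ℝ) / ((C i).length : ℝ))) atTop (𝓝 0) →
      Tendsto (fun i => min (C i).rate (C i).relDist) atTop (𝓝 0) ∧
      (((∃ r : ℝ, Tendsto (fun i => (C i).rate) atTop (𝓝 r)) ∨
          (∃ δ : ℝ, Tendsto (fun i => (C i).relDist) atTop (𝓝 δ))) →
        Tendsto (fun i => (C i).rate) atTop (𝓝 0) ∨
          Tendsto (fun i => (C i).relDist) atTop (𝓝 0))) ∧
    (∀ t : ℕ, ¬ AsymptoticallyGood (TW F t)) := by
  refine ⟨fun C hn h => ?_, fun t ⟨C, hC, hn, hk, hd⟩ => ?_⟩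
  · have hmin := LinCode.tendsto_min_rate_relDist hn h
    refine ⟨hmin, ?_⟩
    rintro (⟨r, hr⟩ | ⟨δ, hδ⟩)
    · obtain rfl | hpos := (ge_of_tendsto' hr fun i => (C i).rate_nonneg).eq_or_lt
      · exact .inl hr
      · exact .inr (tendsto_zero_of_tendsto_min hpos hr hmin)
    · obtain rfl | hpos := (ge_of_tendsto' hδ fun i => (C i).relDist_nonneg).eq_or_lt
      · exact .inr hδ
      · exact .inl (tendsto_zero_of_tendsto_min hpos hδ (by simpa only [min_comm] using hmin))
  · have hmin := LinCode.tendsto_min_rate_relDist (hn.eventually_gt_atTop 1)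
      (LinCode.tendsto_treewidth_mul_log_div hC hn)
    -- Positive lower limits would keep the minimum eventually above `min a b > 0`, against its
    -- limit `0`.
    obtain ⟨a, ha0, ha⟩ := exists_between hk
    obtain ⟨b, hb0, hb⟩ := exists_between hd
    have hka := eventually_lt_of_lt_liminf ha
      (isBoundedUnder_of ⟨0, fun i => (C i).rate_nonneg⟩)
    have hdb := eventually_lt_of_lt_liminf hb
      (isBoundedUnder_of ⟨0, fun i => (C i).relDist_nonneg⟩)
    obtain ⟨i, h1, h2, h3⟩ :=
      (hka.and (hdb.and (hmin.eventually (gt_mem_nhds (lt_min ha0 hb0))))).exists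
    exact absurd h3 (not_lt.2 (min_le_min h1.le h2.le))
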